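/- Let $n\ge 2$. For the Cauchy process on $\mathbb R^n$ (the isotropic $\alpha$-stable process with $\alpha=1$) write $$p_t(x,y)=\frac{c_n\,t}{(t^2+|y-x|^2)^{(n+1)/2}},\qquad c_n=\Gamma\!\left(\tfrac{n+1}{2}\right)\pi^{-(n+1)/2},$$ for its transition density, $P_tf(x)=\int_{\mathbb R^n} f(y)\,p_t(x,y)\,dy$ ($t>0$) for its semigroup, and $$J(x,dy)=\frac{\mathcal A_{n,1}}{|y-x|^{n+1}}\,dy,\qquad \mathcal A_{n,\alpha}=\frac{2^{\alpha}\,\Gamma((n+\alpha)/2)\,\pi^{-n/2}}{|\Gamma(-\alpha/2)|},$$ for its jumping kernel. Let $$\Gamma[u](x)=\frac12\int_{\mathbb R^n\setminus\{x\}}(u(y)-u(x))^2\,J(x,dy)\in[0,\infty]$$ be the carré du champ operator, and for $1<p<\infty$ and $f\in L^p(\mathbb R^n)$ let $$H(x)=H_f(x)=\left(\int_0^\infty P_t\,\Gamma[P_tf](x)\,dt\right)^{1/2}\in[0,\infty],\qquad x\in\mathbb R^n,$$ be the associated square function. Let $f(x)=|x|^{-(n+1)/2}\,\mathbf 1_{B(0,1)}(x)$,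 where $B(0,1)$ is the unit ball. Then: 1. $1<\frac{2n}{n+1}<2$, and $f\in L^p(\mathbb R^n)$ for every $1<p<\frac{2n}{n+1}$. 2. $H_f(x)=\infty$ for every $x\in\mathbb R^n$. 3. For every $1<p<\frac{2n}{n+1}$ there is no constant $C<\infty$ such that $\|H_g\|_p\le C\|g\|_p$ for all $g\in L^p(\mathbb R^n)$. Consequently, for every $1<p<2$ there is no universal constant $C<\infty$ (depending on $p$ only) such that $\|H_g\|_p\le C\|g\|_p$ for the Cauchy process on $\mathbb R^n$ for all $n\ge2$ and all $g\in L^p(\mathbb R^n)$. -/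

import Mathlib

open MeasureTheory
open scoped ENNReal NNReal

noncomputable section

namespace SquareFn

section General

variable {E : Type*} [MeasurableSpace E]

/-- The action `P f (x) = ∫ f(y) P(x, dy)` of a transition function on real functions. -/
def act (P : E → Measure E) (f : E → ℝ) (x : E) : ℝ :=
  ∫ y, f y ∂(P x)

/-- The action of a transition function on `[0, ∞]`-valued functions. -/
def lact (P : E → Measure E) (g : E → ℝ≥0∞) (x : E) : ℝ≥0∞ :=
  ∫⁻ y, g y ∂(P x)

/-- The carré du champ operator of the jumping kernel `J(x, dy)`:
`Γ[u](x) = (1/2) ∫_{E \ {x}} (u(y) - u(x))² J(x, dy)`, possibly infinite. -/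
def carreDuChamp (J : E → Measure E) (u : E → ℝ) (x : E) : ℝ≥0∞ :=
  (1 / 2) * ∫⁻ y in {x}ᶜ, ENNReal.ofReal ((u y - u x) ^ 2) ∂(J x)

/-- The square function `H(x) = (∫_0^∞ P_t Γ[P_t f](x) dt)^{1/2}` of `f`, for the transition
functions `P_t(x, dy)` and the jumping kernel `J(x, dy)`. -/
def squareH (P : ℝ → E → Measure E) (J : E → Measure E) (f : E → ℝ) (x : E) : ℝ≥0∞ :=
  (∫⁻ t in Set.Ioi (0 : ℝ), lact (P t) (carreDuChamp J (act (P t) f)) x) ^ (1 / 2 : ℝ)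

end General

/-- The constant `𝒜_{n,α} = 2^α Γ((n+α)/2) π^{-n/2} / |Γ(-α/2)|`. -/
def stableConst (n : ℕ) (α : ℝ) : ℝ :=
  2 ^ α * Real.Gamma ((n + α) / 2) * Real.pi ^ (-((n : ℝ) / 2)) / |Real.Gamma (-α / 2)|

/-- The jumping kernel `J(x, dy) = 𝒜_{n,1} |y - x|^{-(n+1)} dy` of the Cauchy process. -/
def cauchyJump (n : ℕ) (x : EuclideanSpace ℝ (Fin n)) : Measure (EuclideanSpace ℝ (Fin n)) :=
  volume.withDensity fun y => ENNReal.ofReal (stableConst n 1 / ‖y - x‖ ^ (n + 1))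

/-- The transition density `p_t(x, y) = c_n t / (t² + |y - x|²)^{(n+1)/2}` of the Cauchy process,
with `c_n = Γ((n+1)/2) π^{-(n+1)/2}`. -/
def cauchyDensity (n : ℕ) (t : ℝ) (x y : EuclideanSpace ℝ (Fin n)) : ℝ :=
  Real.Gamma (((n : ℝ) + 1) / 2) * Real.pi ^ (-(((n : ℝ) + 1) / 2)) * t /
    (t ^ 2 + ‖y - x‖ ^ 2) ^ (((n : ℝ) + 1) / 2)

/-- The transition function `P_t(x, dy) = p_t(x, y) dy` of the Cauchy process: the law at time
`t > 0` of the process started at `x`. -/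
def cauchyTransition (n : ℕ) (t : ℝ) (x : EuclideanSpace ℝ (Fin n)) :
    Measure (EuclideanSpace ℝ (Fin n)) :=
  volume.withDensity fun y => ENNReal.ofReal (cauchyDensity n t x y)

/-- The square function `H` of `f` for the Cauchy process on `ℝⁿ`. -/
def cauchyH (n : ℕ) (f : EuclideanSpace ℝ (Fin n) → ℝ) (x : EuclideanSpace ℝ (Fin n)) : ℝ≥0∞ :=
  squareH (cauchyTransition n) (cauchyJump n) f x

/-- The function `f(x) = |x|^{-(n+1)/2} 1_{B(0,1)}(x)`. (Its value at the single point `0`, here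
`0` by the convention for real powers, plays no role.) -/
def singularFn (n : ℕ) : EuclideanSpace ℝ (Fin n) → ℝ :=
  (Metric.ball 0 1).indicator fun x => ‖x‖ ^ (-(((n : ℝ) + 1) / 2))

end SquareFn

end

namespace SquareFn

/-! Put q = (n+1)/2. For small t, `P_t f` has a peak of height about t^(-q) on B(0,t)
(`exists_le_act_singularFn`), while at |y| ≥ √t it is smaller by a factor of order √t
(`exists_act_singularFn_le`). Jumps from y into B(0,t) alone therefore give Γ[P_t f](y) ≳ t^(-2q) ·
t^n / D^(n+1) = 1/(t D^(n+1)), where D bounds the jump length (`exists_le_carreDuChamp`). The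
nonlocal kernel thus lets every distant point feel the singularity. Averaging by `P_t` keeps a lower
bound K/t at each x (`exists_div_le_lact`), and ∫ dt/t diverges at 0, so H is identically infinite.
Since f lies in L^p for p < 2n/(n+1), no L^p bound can hold; as 2n/(n+1) → 2, every p < 2 is reached
by some dimension. -/

theorem sq_rpow_half (n : ℕ) {s : ℝ} (hs : 0 ≤ s) : (s ^ 2) ^ (((n : ℝ) + 1) / 2) = s ^ (n + 1) := by
  rw [← Real.rpow_natCast s 2, ← Real.rpow_mul hs, ← Real.rpow_natCast]
  congr 1
  push_cast
  ring

theorem sqrt_pow_succ (n : ℕ) {t : ℝ} (ht : 0 ≤ t) : √t ^ (n + 1) = t ^ (((n : ℝ) + 1) / 2) := by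
  rw [← sq_rpow_half n (Real.sqrt_nonneg t), Real.sq_sqrt ht]

theorem rpow_neg_half_sq (n : ℕ) {t : ℝ} (ht : 0 < t) :
    (t ^ (-(((n : ℝ) + 1) / 2))) ^ 2 = 1 / t ^ (n + 1) := by
  rw [Real.rpow_neg ht.le, inv_pow, ← sq_rpow_half n ht.le, one_div, ← Real.rpow_natCast,
    ← Real.rpow_natCast t 2, ← Real.rpow_mul ht.le, ← Real.rpow_mul ht.le, mul_comm]

/-! ### Bounds, scaling and integrability of the Cauchy density. -/

/-- The normalizing constant of the Cauchy density. -/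
noncomputable def cauchyConst (n : ℕ) : ℝ :=
  Real.Gamma (((n : ℝ) + 1) / 2) * Real.pi ^ (-(((n : ℝ) + 1) / 2))

theorem cauchyConst_pos (n : ℕ) : 0 < cauchyConst n :=
  mul_pos (Real.Gamma_pos_of_pos (by positivity)) (by positivity)

theorem stableConst_one_pos (n : ℕ) : 0 < stableConst n 1 := by
  have h1 : 0 < Real.Gamma (((n : ℝ) + 1) / 2) := Real.Gamma_pos_of_pos (by positivity)
  -- `Real.Gamma` is 0 at its poles, so -1/2 has to be excluded from them.
  have h2 : Real.Gamma (-1 / 2) ≠ 0 := by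
    refine Real.Gamma_ne_zero fun m hm => ?_
    have h : (1 : ℝ) = ((2 * m : ℕ) : ℝ) := by push_cast; linarith
    have h' : 1 = 2 * m := by exact_mod_cast h
    omega
  unfold stableConst
  positivity

theorem cauchyDensity_eq (n : ℕ) (t : ℝ) (x y : EuclideanSpace ℝ (Fin n)) :
    cauchyDensity n t x y =
      cauchyConst n * t / (t ^ 2 + ‖y - x‖ ^ 2) ^ (((n : ℝ) + 1) / 2) := rfl

theorem cauchyDensity_nonneg (n : ℕ) {t : ℝ} (ht : 0 ≤ t) (x y : EuclideanSpace ℝ (Fin n)) :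
    0 ≤ cauchyDensity n t x y := by
  have := cauchyConst_pos n
  rw [cauchyDensity_eq]
  positivity

theorem measurable_cauchyDensity (n : ℕ) (t : ℝ) (x : EuclideanSpace ℝ (Fin n)) :
    Measurable (cauchyDensity n t x) := by
  unfold cauchyDensity
  fun_prop

/-- Both t and |y - x| are controlled by the free scale s, so t² + |y - x|² ≤ (1 + k²)s². The scales
used later are s = t and s = √t. -/
theorem le_cauchyDensity (n : ℕ) {t s k : ℝ} (ht : 0 < t) (hts : t ≤ s)
    {x y : EuclideanSpace ℝ (Fin n)} (hk : ‖y - x‖ ≤ k * s) :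
    cauchyConst n / (1 + k ^ 2) ^ (((n : ℝ) + 1) / 2) * (t / s ^ (n + 1)) ≤
      cauchyDensity n t x y := by
  have hc := cauchyConst_pos n
  have hs : 0 < s := ht.trans_le hts
  rw [cauchyDensity_eq, ← sq_rpow_half n hs.le, div_mul_div_comm,
    ← Real.mul_rpow (by positivity) (by positivity)]
  gcongr
  nlinarith [pow_le_pow_left₀ ht.le hts 2, pow_le_pow_left₀ (norm_nonneg _) hk 2]

theorem cauchyDensity_le (n : ℕ) {t r : ℝ} (ht : 0 ≤ t) (hr : 0 < r)
    {x y : EuclideanSpace ℝ (Fin n)} (h : r ≤ ‖y - x‖ ∨ r ≤ t) :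
    cauchyDensity n t x y ≤ cauchyConst n * t / r ^ (n + 1) := by
  have hc := cauchyConst_pos n
  rw [cauchyDensity_eq, ← sq_rpow_half n hr.le]
  gcongr
  rcases h with h | h
  · nlinarith [pow_le_pow_left₀ hr.le h 2]
  · nlinarith [pow_le_pow_left₀ hr.le h 2, sq_nonneg ‖y - x‖]

theorem integrable_cauchyDensity_one (n : ℕ) :
    Integrable (cauchyDensity n 1 0) := by
  have h := (integrable_rpow_neg_one_add_norm_sq (E := EuclideanSpace ℝ (Fin n)) (μ := volume)
    (r := (n : ℝ) + 1) (by simp)).const_mul (cauchyConst n)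
  refine h.congr (.of_forall fun y => ?_)
  simp only [cauchyDensity_eq, one_pow, sub_zero, mul_one]
  rw [neg_div, Real.rpow_neg (by positivity)]
  rfl

theorem cauchyDensity_scale (n : ℕ) {t : ℝ} (ht : 0 < t) (x y : EuclideanSpace ℝ (Fin n)) :
    cauchyDensity n t x y = (t ^ n)⁻¹ * cauchyDensity n 1 0 (t⁻¹ • (y - x)) := by
  have h : t ^ 2 + ‖y - x‖ ^ 2 = t ^ 2 * (1 ^ 2 + ‖t⁻¹ • (y - x) - 0‖ ^ 2) := by
    rw [sub_zero, norm_smul, norm_inv, Real.norm_of_nonneg ht.le]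
    field_simp
  rw [cauchyDensity_eq, cauchyDensity_eq, h, Real.mul_rpow (by positivity) (by positivity),
    sq_rpow_half n ht.le]
  field_simp
  ring

theorem integrable_cauchyDensity (n : ℕ) {t : ℝ} (ht : 0 < t) (x : EuclideanSpace ℝ (Fin n)) :
    Integrable (cauchyDensity n t x) := by
  have h := (((integrable_cauchyDensity_one n).comp_smul (inv_ne_zero ht.ne')).comp_sub_right
    x).const_mul (t ^ n)⁻¹
  exact h.congr (.of_forall fun y => (cauchyDensity_scale n ht x y).symm)

/-- Only independence of t and x is needed; the total mass is never computed. -/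
theorem integral_cauchyDensity (n : ℕ) {t : ℝ} (ht : 0 < t) (x : EuclideanSpace ℝ (Fin n)) :
    ∫ y, cauchyDensity n t x y = ∫ y, cauchyDensity n 1 0 y := by
  simp_rw [cauchyDensity_scale n ht x]
  rw [integral_const_mul, integral_sub_right_eq_self (fun y => cauchyDensity n 1 0 (t⁻¹ • y)) x,
    Measure.integral_comp_inv_smul_of_nonneg _ _ ht.le]
  simp only [finrank_euclideanSpace, Fintype.card_fin, smul_eq_mul]
  field_simp

theorem act_cauchyTransition (n : ℕ) {t : ℝ} (ht : 0 ≤ t) (f : EuclideanSpace ℝ (Fin n) → ℝ)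
    (x : EuclideanSpace ℝ (Fin n)) :
    act (cauchyTransition n t) f x = ∫ y, cauchyDensity n t x y * f y := by
  unfold act cauchyTransition
  rw [integral_withDensity_eq_integral_toReal_smul
    (measurable_cauchyDensity n t x).ennreal_ofReal (by simp)]
  simp [ENNReal.toReal_ofReal, cauchyDensity_nonneg n ht]

/-! ### Integrability of the singular function. -/

theorem singularFn_nonneg (n : ℕ) (x : EuclideanSpace ℝ (Fin n)) : 0 ≤ singularFn n x :=
  Set.indicator_nonneg (fun _ _ => by positivity) x

theorem measurable_singularFn (n : ℕ) : Measurable (singularFn n) :=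
  (by fun_prop : Measurable fun x : EuclideanSpace ℝ (Fin n) =>
    ‖x‖ ^ (-(((n : ℝ) + 1) / 2))).indicator measurableSet_ball

theorem singularFn_le (n : ℕ) (x : EuclideanSpace ℝ (Fin n)) :
    singularFn n x ≤ ‖x‖ ^ (-(((n : ℝ) + 1) / 2)) :=
  Set.indicator_le_self' (fun _ _ => by positivity) x

theorem integrable_singularFn_rpow (n : ℕ) (hn : 2 ≤ n) {p : ℝ} (hp : 1 ≤ p)
    (hp' : p < 2 * (n : ℝ) / (n + 1)) : Integrable fun x => singularFn n x ^ p := by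
  have h : (fun x => singularFn n x ^ p) =
      (Metric.ball 0 1).indicator fun x => ‖x‖ ^ (-(((n : ℝ) + 1) / 2) * p) := by
    ext x
    by_cases hx : x ∈ Metric.ball (0 : EuclideanSpace ℝ (Fin n)) 1
    · simp only [singularFn, Set.indicator_of_mem hx]
      rw [Real.rpow_mul (norm_nonneg x)]
    · simp only [singularFn, Set.indicator_of_notMem hx]
      exact Real.zero_rpow (by linarith)
  have : Nontrivial (EuclideanSpace ℝ (Fin n)) :=
    Module.nontrivial_of_finrank_pos (R := ℝ) (by simp; omega)
  rw [h, integrable_indicator_iff measurableSet_ball,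
    integrableOn_fun_norm_addHaar volume (f := fun r : ℝ => r ^ (-(((n : ℝ) + 1) / 2) * p))]
  -- In polar coordinates, n - 1 - p(n+1)/2 > -1 is exactly p < 2n/(n+1).
  have h2 : IntegrableOn (fun y : ℝ => y ^ ((n - 1 : ℕ) + -(((n : ℝ) + 1) / 2) * p))
      (Set.Ioo 0 1) := by
    rw [intervalIntegral.integrableOn_Ioo_rpow_iff one_pos]
    push_cast [Nat.cast_sub (by omega : 1 ≤ n)]
    rw [lt_div_iff₀ (by positivity)] at hp'
    nlinarith
  refine h2.congr_fun (fun y hy => ?_) measurableSet_Ioo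
  simp only [finrank_euclideanSpace, Fintype.card_fin, smul_eq_mul]
  rw [Real.rpow_add hy.1, Real.rpow_natCast]

theorem one_lt_critical (n : ℕ) (hn : 2 ≤ n) : 1 < 2 * (n : ℝ) / (n + 1) := by
  have : (2 : ℝ) ≤ n := by exact_mod_cast hn
  rw [lt_div_iff₀ (by positivity)]
  linarith

theorem critical_lt_two (n : ℕ) : 2 * (n : ℝ) / (n + 1) < 2 := by
  rw [div_lt_iff₀ (by positivity)]
  linarith

theorem integrable_singularFn (n : ℕ) (hn : 2 ≤ n) : Integrable (singularFn n) := by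
  simpa using integrable_singularFn_rpow n hn le_rfl (one_lt_critical n hn)

theorem memLp_singularFn (n : ℕ) (hn : 2 ≤ n) {p : ℝ} (hp : 1 < p)
    (hp' : p < 2 * (n : ℝ) / (n + 1)) : MemLp (singularFn n) (ENNReal.ofReal p) := by
  rw [← integrable_norm_rpow_iff (measurable_singularFn n).aestronglyMeasurable
    (by simp; linarith) (by simp), ENNReal.toReal_ofReal (by linarith)]
  simpa [abs_of_nonneg (singularFn_nonneg n _)] using integrable_singularFn_rpow n hn hp.le hp'

theorem integrable_cauchyDensity_mul_singularFn (n : ℕ) (hn : 2 ≤ n) {t : ℝ} (ht : 0 < t)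
    (x : EuclideanSpace ℝ (Fin n)) :
    Integrable fun y => cauchyDensity n t x y * singularFn n y := by
  refine (integrable_singularFn n hn).bdd_mul (c := cauchyConst n * t / t ^ (n + 1))
    (measurable_cauchyDensity n t x).aestronglyMeasurable (.of_forall fun y => ?_)
  rw [Real.norm_of_nonneg (cauchyDensity_nonneg n ht.le x y)]
  exact cauchyDensity_le n ht.le ht (.inr le_rfl)

/-! ### Size of `P_t f` near and away from the origin. -/

/-- Near the origin, `P_t f` is at least of order `t^{-(n+1)/2}`. -/
theorem exists_le_act_singularFn (n : ℕ) (hn : 2 ≤ n) :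
    ∃ m : ℝ, 0 < m ∧ ∀ t : ℝ, 0 < t → t ≤ 1 → ∀ z : EuclideanSpace ℝ (Fin n), ‖z‖ < t →
      m * t ^ (-(((n : ℝ) + 1) / 2)) ≤ act (cauchyTransition n t) (singularFn n) z := by
  have : Nontrivial (EuclideanSpace ℝ (Fin n)) :=
    Module.nontrivial_of_finrank_pos (R := ℝ) (by simp; omega)
  have hc := cauchyConst_pos n
  have hv : 0 < volume.real (Metric.ball (0 : EuclideanSpace ℝ (Fin n)) 1) :=
    ENNReal.toReal_pos (Metric.measure_ball_pos _ _ one_pos).ne' measure_ball_lt_top.ne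
  refine ⟨cauchyConst n / (1 + 2 ^ 2) ^ (((n : ℝ) + 1) / 2) *
    volume.real (Metric.ball (0 : EuclideanSpace ℝ (Fin n)) 1), by positivity,
    fun t ht ht1 z hz => ?_⟩
  rw [act_cauchyTransition n ht.le]
  have hint := integrable_cauchyDensity_mul_singularFn n hn ht z
  have hvt : volume.real (Metric.ball (0 : EuclideanSpace ℝ (Fin n)) t) =
      t ^ n * volume.real (Metric.ball (0 : EuclideanSpace ℝ (Fin n)) 1) := by
    simp only [Measure.real]
    rw [Measure.addHaar_ball _ _ ht.le, ENNReal.toReal_mul, ENNReal.toReal_ofReal (by positivity)]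
    simp
  calc _ = ∫ _ in Metric.ball (0 : EuclideanSpace ℝ (Fin n)) t,
        cauchyConst n / (1 + 2 ^ 2) ^ (((n : ℝ) + 1) / 2) * (t / t ^ (n + 1)) *
          t ^ (-(((n : ℝ) + 1) / 2)) := by
        rw [setIntegral_const, hvt, smul_eq_mul]
        field_simp
        ring
    _ ≤ ∫ y in Metric.ball (0 : EuclideanSpace ℝ (Fin n)) t,
        cauchyDensity n t z y * singularFn n y := by
        refine setIntegral_mono_on_ae (integrableOn_const measure_ball_lt_top.ne)
          hint.integrableOn measurableSet_ball ?_
        -- The origin is discarded because the function takes the default value 0 there.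
        filter_upwards [Measure.ae_ne volume (0 : EuclideanSpace ℝ (Fin n))] with y hy0 hy
        rw [mem_ball_zero_iff] at hy
        have hy1 : y ∈ Metric.ball (0 : EuclideanSpace ℝ (Fin n)) 1 := by
          rw [mem_ball_zero_iff]; linarith
        have h1 : ‖y - z‖ ≤ 2 * t := (norm_sub_le y z).trans (by linarith)
        refine mul_le_mul (le_cauchyDensity n ht le_rfl h1) ?_ (by positivity)
          (cauchyDensity_nonneg n ht.le _ _)
        rw [singularFn, Set.indicator_of_mem hy1]
        exact Real.rpow_le_rpow_of_nonpos (norm_pos_iff.2 hy0) hy.le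
          (neg_nonpos.2 (by positivity))
    _ ≤ _ := setIntegral_le_integral hint (.of_forall fun y =>
        mul_nonneg (cauchyDensity_nonneg n ht.le _ _) (singularFn_nonneg n y))

/-- At distance at least `√t` from the origin, `P_t f` is at most of order `√t t^{-(n+1)/2}`. -/
theorem exists_act_singularFn_le (n : ℕ) (hn : 2 ≤ n) :
    ∃ C : ℝ, 0 < C ∧ ∀ t : ℝ, 0 < t → t ≤ 1 → ∀ y : EuclideanSpace ℝ (Fin n), √t ≤ ‖y‖ →
      act (cauchyTransition n t) (singularFn n) y ≤ C * √t * t ^ (-(((n : ℝ) + 1) / 2)) := by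
  have hc := cauchyConst_pos n
  set F := ∫ x, singularFn n x
  set M := ∫ x, cauchyDensity n 1 0 x
  have hF : 0 ≤ F := integral_nonneg (singularFn_nonneg n)
  have hM : 0 ≤ M := integral_nonneg (cauchyDensity_nonneg n zero_le_one 0)
  set q : ℝ := ((n : ℝ) + 1) / 2 with hq
  have hq1 : 1 ≤ q := by
    have : (2 : ℝ) ≤ n := by exact_mod_cast hn
    rw [hq]; linarith
  -- The two terms come from |w| ≤ √t/2 and |w| ≥ √t/2; the extra 1 gives strict positivity, as F
  -- and M are only known to be nonnegative.
  refine ⟨cauchyConst n * 2 ^ (n + 1) * F + 2 ^ q * M + 1, by positivity,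
    fun t ht ht1 y hy => ?_⟩
  have hs : 0 < √t := Real.sqrt_pos.2 ht
  have hy0 : 0 < √t / 2 := by positivity
  have hs1 : √t ≤ 1 := Real.sqrt_le_one.2 ht1
  rw [act_cauchyTransition n ht.le]
  have hI1 := (integrable_singularFn n hn).const_mul (cauchyConst n * t / (√t / 2) ^ (n + 1))
  have hI2 := (integrable_cauchyDensity n ht y).const_mul ((√t / 2) ^ (-q))
  have key : ∫ w, cauchyDensity n t y w * singularFn n w ≤
      cauchyConst n * t / (√t / 2) ^ (n + 1) * F + (√t / 2) ^ (-q) * M := by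
    rw [show M = _ from (integral_cauchyDensity n ht y).symm, ← integral_const_mul, ← integral_const_mul,
      ← integral_add hI1 hI2]
    refine integral_mono (integrable_cauchyDensity_mul_singularFn n hn ht y) (hI1.add hI2)
      fun w => ?_
    have hp := cauchyDensity_nonneg n ht.le y w
    have hf := singularFn_nonneg n w
    beta_reduce
    -- Either w is far from the singularity, so f is bounded by (√t/2)^(-q), or w is far from y, so
    -- the density is small.
    rcases le_total (√t / 2) ‖w‖ with hw | hw
    · have h1 : singularFn n w ≤ (√t / 2) ^ (-q) := (singularFn_le n w).trans
        (Real.rpow_le_rpow_of_nonpos hy0 hw (by linarith))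
      have h2 : 0 ≤ cauchyConst n * t / (√t / 2) ^ (n + 1) * singularFn n w := by positivity
      nlinarith [mul_le_mul_of_nonneg_left h1 hp]
    · have h1 : √t / 2 ≤ ‖w - y‖ := by
        have := norm_sub_norm_le y w
        rw [norm_sub_rev] at this
        linarith
      have h2 := mul_le_mul_of_nonneg_right (cauchyDensity_le n ht.le hy0 (.inl h1)) hf
      have h3 : 0 ≤ (√t / 2) ^ (-q) * cauchyDensity n t y w := by positivity
      linarith
  refine key.trans ?_
  have e1 : cauchyConst n * t / (√t / 2) ^ (n + 1) * F =
      cauchyConst n * 2 ^ (n + 1) * F * (t * t ^ (-q)) := by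
    rw [div_pow, sqrt_pow_succ n ht.le, Real.rpow_neg ht.le, ← hq]
    field_simp
  have e2 : (√t / 2) ^ (-q) * M = 2 ^ q * M * (√t) ^ (-q) := by
    rw [Real.div_rpow hs.le (by norm_num), Real.rpow_neg (by norm_num : (0:ℝ) ≤ 2)]
    field_simp
  -- With s = √t ≤ 1 this reads s^(-q) ≤ s^(1-2q), which is where q ≥ 1 enters.
  have e3 : (√t) ^ (-q) ≤ √t * t ^ (-q) := by
    have : t ^ (-q) = √t ^ (-q) * √t ^ (-q) := by
      rw [← Real.mul_rpow hs.le hs.le, Real.mul_self_sqrt ht.le]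
    have h4 : 1 ≤ √t * √t ^ (-q) := by
      have : √t ^ (-1 : ℝ) ≤ √t ^ (-q) := Real.rpow_le_rpow_of_exponent_ge hs hs1 (by linarith)
      rw [Real.rpow_neg_one] at this
      calc 1 = √t * (√t)⁻¹ := by field_simp
        _ ≤ _ := by gcongr
    rw [this, ← mul_assoc]
    exact le_mul_of_one_le_left (by positivity) h4
  have e4 : t ≤ √t := by nlinarith [Real.mul_self_sqrt ht.le]
  have hpos : 0 < t ^ (-q) := Real.rpow_pos_of_pos ht _
  rw [e1, e2]
  calc _ ≤ cauchyConst n * 2 ^ (n + 1) * F * (√t * t ^ (-q)) + 2 ^ q * M * (√t * t ^ (-q)) := by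
        gcongr
    _ ≤ _ := by nlinarith [mul_pos hs hpos]

/-! ### Lower bound for the carré du champ. -/

theorem le_lintegral_withDensity {E : Type*} [MeasurableSpace E] {μ : Measure E}
    {d g : E → ℝ≥0∞} {S : Set E} (hS : MeasurableSet S) {a b : ℝ≥0∞}
    (hd : ∀ y ∈ S, a ≤ d y) (hg : ∀ y ∈ S, b ≤ g y) :
    b * (a * μ S) ≤ ∫⁻ y in S, g y ∂(μ.withDensity d) :=
  calc b * (a * μ S) ≤ b * μ.withDensity d S := by
        gcongr
        rw [withDensity_apply _ hS, ← setLIntegral_const]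
        exact setLIntegral_mono' hS hd
    _ = ∫⁻ _ in S, b ∂(μ.withDensity d) := (setLIntegral_const _ _).symm
    _ ≤ _ := setLIntegral_mono' hS hg

/-- Only jumps from y into B(0,t) are kept; their length is at most |y| + t. Leaving D free allows D
~ √t for x = 0 and a fixed D otherwise. -/
theorem exists_le_carreDuChamp (n : ℕ) (hn : 2 ≤ n) :
    ∃ c t₀ : ℝ, 0 < c ∧ 0 < t₀ ∧ t₀ ≤ 1 ∧ ∀ t : ℝ, 0 < t → t < t₀ →
      ∀ y : EuclideanSpace ℝ (Fin n), √t ≤ ‖y‖ → ∀ D : ℝ, ‖y‖ + t ≤ D →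
        ENNReal.ofReal (c / (t * D ^ (n + 1))) ≤
          carreDuChamp (cauchyJump n) (act (cauchyTransition n t) (singularFn n)) y := by
  have : Nontrivial (EuclideanSpace ℝ (Fin n)) :=
    Module.nontrivial_of_finrank_pos (R := ℝ) (by simp; omega)
  obtain ⟨m, hm, hlow⟩ := exists_le_act_singularFn n hn
  obtain ⟨C, hC, hup⟩ := exists_act_singularFn_le n hn
  have hA := stableConst_one_pos n
  set v := volume.real (Metric.ball (0 : EuclideanSpace ℝ (Fin n)) 1) with hvdef
  have hv : 0 < v :=
    ENNReal.toReal_pos (Metric.measure_ball_pos _ _ one_pos).ne' measure_ball_lt_top.ne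
  -- The threshold forces C√t ≤ m/2, so the difference between peak and y keeps at least half the
  -- peak's lower bound.
  refine ⟨1 / 2 * ((m / 2) ^ 2 * stableConst n 1 * v), min 1 ((m / (2 * C)) ^ 2), by positivity,
    by positivity, min_le_left _ _, fun t ht ht0 y hy D hD => ?_⟩
  have ht1 : t < 1 := ht0.trans_le (min_le_left _ _)
  have hs : 0 < √t := Real.sqrt_pos.2 ht
  have hst : t < √t := by
    nlinarith [Real.mul_self_sqrt ht.le, (Real.sqrt_lt' one_pos).2 (by simpa using ht1)]
  have hts : C * √t ≤ m / 2 := by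
    have : √t ≤ m / (2 * C) := by
      rw [Real.sqrt_le_left (by positivity)]
      exact (ht0.trans_le (min_le_right _ _)).le
    calc C * √t ≤ C * (m / (2 * C)) := by gcongr
      _ = _ := by field_simp
  have hD0 : 0 < D := by linarith
  set a := t ^ (-(((n : ℝ) + 1) / 2)) with ha
  have ha0 : 0 < a := Real.rpow_pos_of_pos ht _
  set u := act (cauchyTransition n t) (singularFn n)
  have hsub : Metric.ball (0 : EuclideanSpace ℝ (Fin n)) t ⊆ {y}ᶜ := by
    rintro z hz rfl
    rw [mem_ball_zero_iff] at hz
    linarith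
  have hball : volume (Metric.ball (0 : EuclideanSpace ℝ (Fin n)) t) =
      ENNReal.ofReal (t ^ n * v) := by
    rw [Measure.addHaar_ball _ _ ht.le, ENNReal.ofReal_mul (by positivity), hvdef,
      ofReal_measureReal measure_ball_lt_top.ne]
    simp
  have hmain := le_lintegral_withDensity (μ := volume)
    (d := fun z => ENNReal.ofReal (stableConst n 1 / ‖z - y‖ ^ (n + 1)))
    (g := fun z => ENNReal.ofReal ((u z - u y) ^ 2))
    (S := Metric.ball (0 : EuclideanSpace ℝ (Fin n)) t) measurableSet_ball
    (a := ENNReal.ofReal (stableConst n 1 / D ^ (n + 1)))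
    (b := ENNReal.ofReal ((m / 2 * a) ^ 2)) (fun z hz => by
      have hzy : z ≠ y := hsub hz
      rw [mem_ball_zero_iff] at hz
      have h0 : 0 < ‖z - y‖ := norm_pos_iff.2 (sub_ne_zero.2 hzy)
      have h1 : ‖z - y‖ ≤ D := (norm_sub_le z y).trans (by linarith)
      gcongr) (fun z hz => by
      rw [mem_ball_zero_iff] at hz
      have h1 := hlow t ht ht1.le z hz
      have h2 := hup t ht ht1.le y hy
      have h3 : C * √t * a ≤ m / 2 * a := by gcongr
      gcongr
      linarith)
  rw [hball, ← ENNReal.ofReal_mul (by positivity), ← ENNReal.ofReal_mul (by positivity)] at hmain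
  calc ENNReal.ofReal (1 / 2 * ((m / 2) ^ 2 * stableConst n 1 * v) / (t * D ^ (n + 1)))
      = 1 / 2 * ENNReal.ofReal
          ((m / 2 * a) ^ 2 * (stableConst n 1 / D ^ (n + 1) * (t ^ n * v))) := by
        have : (1 / 2 : ℝ≥0∞) = ENNReal.ofReal (1 / 2) := by
          rw [ENNReal.ofReal_div_of_pos two_pos]; simp
        rw [this, ← ENNReal.ofReal_mul (by positivity), mul_pow, rpow_neg_half_sq n ht]
        congr 1
        field_simp
        ring
    _ ≤ carreDuChamp (cauchyJump n) u y := by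
        unfold carreDuChamp cauchyJump
        gcongr
        exact hmain.trans (lintegral_mono_set hsub)

/-! ### Divergence of the square function. -/

theorem lintegral_div_eq_top {K t₁ : ℝ} (hK : 0 < K) (ht₁ : 0 < t₁) :
    ∫⁻ t in Set.Ioo 0 t₁, ENNReal.ofReal (K / t) = ∞ := by
  by_contra h
  have hint : IntegrableOn (fun t : ℝ => K / t) (Set.Ioo 0 t₁) := by
    refine ⟨by fun_prop, ?_⟩
    rw [hasFiniteIntegral_iff_ofReal]
    · exact lt_top_iff_ne_top.2 h
    · filter_upwards [ae_restrict_mem measurableSet_Ioo] with t ht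
      have := ht.1
      positivity
  have h2 : IntegrableOn (fun t : ℝ => t ^ (-1 : ℝ)) (Set.Ioo 0 t₁) := by
    refine (hint.const_mul K⁻¹).congr (.of_forall fun t => ?_)
    simp only [Real.rpow_neg_one]
    field_simp
  rw [intervalIntegral.integrableOn_Ioo_rpow_iff ht₁] at h2
  exact lt_irrefl _ h2

/-- A lower bound for `P_t g(x)` from lower bounds for `p_t(x, ·)` and `g` on a ball of radius `t`. -/
theorem le_lact_cauchyTransition (n : ℕ) (hn : 2 ≤ n) {t k b : ℝ} (ht : 0 < t) (hk : 0 ≤ k)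
    (hb : 0 ≤ b) (x a : EuclideanSpace ℝ (Fin n)) (g : EuclideanSpace ℝ (Fin n) → ℝ≥0∞)
    (hd : ∀ y ∈ Metric.ball a t, k ≤ cauchyDensity n t x y)
    (hg : ∀ y ∈ Metric.ball a t, ENNReal.ofReal b ≤ g y) :
    ENNReal.ofReal (b * (k * (t ^ n *
      volume.real (Metric.ball (0 : EuclideanSpace ℝ (Fin n)) 1)))) ≤
      lact (cauchyTransition n t) g x := by
  have : Nontrivial (EuclideanSpace ℝ (Fin n)) :=
    Module.nontrivial_of_finrank_pos (R := ℝ) (by simp; omega)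
  have hball : volume (Metric.ball a t) = ENNReal.ofReal (t ^ n *
      volume.real (Metric.ball (0 : EuclideanSpace ℝ (Fin n)) 1)) := by
    rw [Measure.addHaar_ball _ _ ht.le, ENNReal.ofReal_mul (by positivity),
      ofReal_measureReal measure_ball_lt_top.ne]
    simp
  rw [ENNReal.ofReal_mul hb, ENNReal.ofReal_mul hk, ← hball]
  exact (le_lintegral_withDensity measurableSet_ball
    (fun y hy => ENNReal.ofReal_le_ofReal (hd y hy)) hg).trans (setLIntegral_le_lintegral _ _)

theorem exists_div_le_lact (n : ℕ) (hn : 2 ≤ n) (x : EuclideanSpace ℝ (Fin n)) :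
    ∃ K t₁ : ℝ, 0 < K ∧ 0 < t₁ ∧ ∀ t : ℝ, 0 < t → t < t₁ → ENNReal.ofReal (K / t) ≤
      lact (cauchyTransition n t)
        (carreDuChamp (cauchyJump n) (act (cauchyTransition n t) (singularFn n))) x := by
  have : Nontrivial (EuclideanSpace ℝ (Fin n)) :=
    Module.nontrivial_of_finrank_pos (R := ℝ) (by simp; omega)
  obtain ⟨c, t₀, hc, ht₀, ht₀1, hΓ⟩ := exists_le_carreDuChamp n hn
  have hcc := cauchyConst_pos n
  set v := volume.real (Metric.ball (0 : EuclideanSpace ℝ (Fin n)) 1) with hvdef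
  have hv : 0 < v :=
    ENNReal.toReal_pos (Metric.measure_ball_pos _ _ one_pos).ne' measure_ball_lt_top.ne
  rcases eq_or_ne x 0 with rfl | hx
  · refine ⟨c / 4 ^ (n + 1) * (cauchyConst n / (1 + 3 ^ 2) ^ (((n : ℝ) + 1) / 2) * v), t₀,
      by positivity, ht₀, fun t ht htt => ?_⟩
    have hs : 0 < √t := Real.sqrt_pos.2 ht
    have hsq := Real.mul_self_sqrt ht.le
    have hst : t ≤ √t := by
      nlinarith [Real.sqrt_le_one.2 (htt.le.trans ht₀1)]
    -- At x = 0 the ball B(x,t) lies where no carré du champ bound is available, so a ball at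
    -- distance 2√t is used. The density there is of order t/√t^(n+1), Γ is at least of order 1/(t
    -- √t^(n+1)), and the volume t^n makes the product of order 1/t.
    obtain ⟨a, ha⟩ := exists_norm_eq (EuclideanSpace ℝ (Fin n)) (c := 2 * √t) (by positivity)
    have hy : ∀ y ∈ Metric.ball a t, √t ≤ ‖y‖ ∧ ‖y‖ ≤ 3 * √t := fun y hy => by
      rw [mem_ball_iff_norm] at hy
      have h1 := norm_sub_norm_le a y
      have h2 := norm_sub_norm_le y a
      rw [norm_sub_rev] at h1
      constructor <;> linarith
    have h := le_lact_cauchyTransition n hn ht (b := c / (t * (4 * √t) ^ (n + 1)))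
      (k := cauchyConst n / (1 + 3 ^ 2) ^ (((n : ℝ) + 1) / 2) * (t / √t ^ (n + 1)))
      (by positivity) (by positivity) 0 a
      (carreDuChamp (cauchyJump n) (act (cauchyTransition n t) (singularFn n)))
      (fun y hya => le_cauchyDensity n ht hst (by simpa using (hy y hya).2))
      (fun y hya => hΓ t ht htt y (hy y hya).1 _ (by linarith [(hy y hya).2]))
    refine le_trans (le_of_eq ?_) h
    congr 1
    have e : √t ^ (n + 1) * √t ^ (n + 1) = t ^ (n + 1) := by rw [← mul_pow, hsq]
    rw [mul_pow, ← hvdef]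
    set w := √t ^ (n + 1)
    set B : ℝ := (1 + 3 ^ 2) ^ (((n : ℝ) + 1) / 2)
    have hB : 0 < B := by positivity
    have hw : 0 < w := by positivity
    calc c / 4 ^ (n + 1) * (cauchyConst n / B * v) / t
        = c / 4 ^ (n + 1) * (cauchyConst n / B * v) * (t ^ n / (w * w)) := by
          rw [e]; field_simp; ring
      _ = _ := by field_simp
  -- Away from 0 the ball B(x,t) itself works: it carries `P_t`-mass bounded below, and Γ is at
  -- least of order 1/t on it once √t ≤ |x|/2.
  · have hx0 : 0 < ‖x‖ := norm_pos_iff.2 hx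
    refine ⟨c / (‖x‖ + 2) ^ (n + 1) * (cauchyConst n / (1 + 1 ^ 2) ^ (((n : ℝ) + 1) / 2) * v),
      min t₀ ((‖x‖ / 2) ^ 2), by positivity, by positivity, fun t ht htt => ?_⟩
    have htt₀ : t < t₀ := htt.trans_le (min_le_left _ _)
    have hs : 0 < √t := Real.sqrt_pos.2 ht
    have hst : t ≤ √t := by
      nlinarith [Real.sqrt_le_one.2 (htt₀.le.trans ht₀1), Real.mul_self_sqrt ht.le]
    have hsx : √t ≤ ‖x‖ / 2 := by
      rw [Real.sqrt_le_left (by positivity)]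
      exact (htt.trans_le (min_le_right _ _)).le
    have hy : ∀ y ∈ Metric.ball x t, √t ≤ ‖y‖ ∧ ‖y‖ ≤ ‖x‖ + t := fun y hy => by
      rw [mem_ball_iff_norm] at hy
      have h1 := norm_sub_norm_le x y
      have h2 := norm_sub_norm_le y x
      rw [norm_sub_rev] at h1
      constructor <;> linarith
    have h := le_lact_cauchyTransition n hn ht (b := c / (t * (‖x‖ + 2) ^ (n + 1)))
      (k := cauchyConst n / (1 + 1 ^ 2) ^ (((n : ℝ) + 1) / 2) * (t / t ^ (n + 1)))
      (by positivity) (by positivity) x x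
      (carreDuChamp (cauchyJump n) (act (cauchyTransition n t) (singularFn n)))
      (fun y hya => le_cauchyDensity n ht le_rfl
        (by rw [one_mul]; exact (mem_ball_iff_norm.1 hya).le))
      (fun y hya => hΓ t ht htt₀ y (hy y hya).1 _ (by linarith [(hy y hya).2]))
    refine le_trans (le_of_eq ?_) h
    congr 1
    rw [← hvdef]
    field_simp
    ring

theorem cauchyH_singularFn (n : ℕ) (hn : 2 ≤ n) (x : EuclideanSpace ℝ (Fin n)) :
    cauchyH n (singularFn n) x = ∞ := by
  obtain ⟨K, t₁, hK, ht₁, h⟩ := exists_div_le_lact n hn x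
  unfold cauchyH squareH
  rw [ENNReal.rpow_eq_top_iff_of_pos (by norm_num), ← top_le_iff, ← lintegral_div_eq_top hK ht₁]
  exact (setLIntegral_mono' measurableSet_Ioo fun t ht => h t ht.1 ht.2).trans
    (lintegral_mono_set Set.Ioo_subset_Ioi_self)

theorem not_eLpNorm_cauchyH_le (n : ℕ) (hn : 2 ≤ n) {p : ℝ} (hp : 1 < p)
    (hp' : p < 2 * (n : ℝ) / (n + 1)) (C : ℝ≥0) :
    ¬ eLpNorm (cauchyH n (singularFn n)) (ENNReal.ofReal p) volume ≤
      C * eLpNorm (singularFn n) (ENNReal.ofReal p) volume := by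
  have h1 : cauchyH n (singularFn n) = fun _ => ∞ := funext (cauchyH_singularFn n hn)
  have hp0 : ENNReal.ofReal p ≠ 0 := by simp; linarith
  rw [h1, eLpNorm_const _ hp0 (NeZero.ne _), not_le]
  have h2 : (volume (Set.univ : Set (EuclideanSpace ℝ (Fin n)))) ^
      (1 / (ENNReal.ofReal p).toReal) ≠ 0 := by
    rw [ENNReal.toReal_ofReal (by linarith), Ne, ENNReal.rpow_eq_zero_iff]
    rintro (⟨h, -⟩ | ⟨-, h⟩)
    · exact (NeZero.ne volume) (Measure.measure_univ_eq_zero.1 h)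
    · have : 0 < 1 / p := by positivity
      linarith
  rw [enorm_eq_self, ENNReal.top_mul h2]
  exact ENNReal.mul_lt_top ENNReal.coe_lt_top (memLp_singularFn n hn hp hp').2

end SquareFn

theorem mainTheorem7 :
    (∀ n : ℕ, 2 ≤ n →
      (1 < 2 * (n : ℝ) / (n + 1) ∧ 2 * (n : ℝ) / (n + 1) < 2) ∧
      (∀ p : ℝ, 1 < p → p < 2 * (n : ℝ) / (n + 1) →
        MemLp (SquareFn.singularFn n) (ENNReal.ofReal p) volume) ∧
      (∀ x : EuclideanSpace ℝ (Fin n), SquareFn.cauchyH n (SquareFn.singularFn n) x = ∞) ∧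
      (∀ p : ℝ, 1 < p → p < 2 * (n : ℝ) / (n + 1) →
        ¬ ∃ C : ℝ≥0, ∀ f : EuclideanSpace ℝ (Fin n) → ℝ, MemLp f (ENNReal.ofReal p) volume →
          eLpNorm (SquareFn.cauchyH n f) (ENNReal.ofReal p) volume ≤
            C * eLpNorm f (ENNReal.ofReal p) volume)) ∧
    (∀ p : ℝ, 1 < p → p < 2 →
      ¬ ∃ C : ℝ≥0, ∀ n : ℕ, 2 ≤ n → ∀ f : EuclideanSpace ℝ (Fin n) → ℝ,
        MemLp f (ENNReal.ofReal p) volume →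
          eLpNorm (SquareFn.cauchyH n f) (ENNReal.ofReal p) volume ≤
            C * eLpNorm f (ENNReal.ofReal p) volume) := by
  refine ⟨fun n hn => ⟨⟨SquareFn.one_lt_critical n hn, SquareFn.critical_lt_two n⟩,
    fun p hp hp' => SquareFn.memLp_singularFn n hn hp hp', SquareFn.cauchyH_singularFn n hn,
    fun p hp hp' ⟨C, hC⟩ => SquareFn.not_eLpNorm_cauchyH_le n hn hp hp' C
      (hC _ (SquareFn.memLp_singularFn n hn hp hp'))⟩, fun p hp hp2 ⟨C, hC⟩ => ?_⟩
  -- p < 2n/(n+1) is equivalent to n > p/(2-p); the shift to N + 2 ensures n ≥ 2.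
  obtain ⟨N, hN⟩ := exists_nat_gt (p / (2 - p))
  have hN2 : (N : ℝ) ≤ (N + 2 : ℕ) := by push_cast; linarith
  have hp' : p < 2 * ((N + 2 : ℕ) : ℝ) / ((N + 2 : ℕ) + 1) := by
    rw [lt_div_iff₀ (by positivity)]
    rw [div_lt_iff₀ (by linarith)] at hN
    nlinarith
  exact SquareFn.not_eLpNorm_cauchyH_le (N + 2) (by omega) hp hp' C
    (hC _ (by omega) _ (SquareFn.memLp_singularFn (N + 2) (by omega) hp hp'))
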